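/- Let $\mathbb M$ be a Minkowski space, i.e. a finite-dimensional real normed space, with unit ball $B$. A convex body is a nonempty compact convex set. For a convex body $K$ let $D(K)$ be its diameter, $R(K)=\inf\{\rho>0:\exists c,\ K\subset c+\rho B\}$ its circumradius, and $s(K)=\inf\{\rho>0:\exists c,\ -K\subset c+\rho K\}$ its Minkowski asymmetry; a circumcenter of $K$ is a point $c$ with $K\subset c+R(K)B$. A convex body $K$ is complete if $D(K\cup\{x\})>D(K)$ for all $x\notin K$, and a completion of $K$ is a complete body $K^*\supset K$ with $D(K^*)=D(K)$. For a circumcenter $c$ of $K$, the pseudo completion of $K$ with respect to $c$ is $K^+=K^+_c=\operatorname{conv}\big(K\cup(c+(D(K)-R(K))B)\big)$. The asymmetry constant is $s(\mathbb M)=\max\{s(K):K\text{ complete}\}$. The Helly dimension $\operatorname{him}(\mathbb M)$ is the smallest positive integer $k$ such that every nonempty family of translates of $B$, any at most $k+1$ of which have a common point, has a common point. Then the maximum defining $s(\mathbb M)$ is attained, and \[\lceil s(\mathbb M)\rceil\le \operatorname{him}(\mathbb M).\] Moreover, $s(\mathbb M)=\operatorname{him}(\mathbb M)$ if and only if there is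 a $\operatorname{him}(\mathbb M)$-dimensional simplex $S$ with $s(S)=s(S^+)=s(S^*)$ for all completions $S^*$ of $S$; this equivalence holds both when $S^+=S^+_c$ is required to satisfy these equalities for some circumcenter $c$ of $S$ and when it is required to satisfy them for every circumcenter $c$ of $S$. Finally, whenever a $\operatorname{him}(\mathbb M)$-dimensional simplex $S$ satisfies these equalities for some circumcenter, then $S=S^+_c\cap\operatorname{aff}(S)$ for every circumcenter $c$ of $S$. -/

import Mathlib

open scoped Pointwise

noncomputable section

namespace MinkowskiSpace

variable {E : Type*} [NormedAddCommGroup E] [NormedSpace ℝ E]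

/-- A convex body: a nonempty compact convex set (not necessarily with interior points). -/
def IsConvexBody (K : Set E) : Prop :=
  K.Nonempty ∧ IsCompact K ∧ Convex ℝ K

/-- The Minkowski asymmetry `inf {ρ > 0 : -K ⊆ c + ρ K for some c}`. -/
def asymmetry (K : Set E) : ℝ :=
  sInf {ρ : ℝ | 0 < ρ ∧ ∃ c : E, -K ⊆ {c} + ρ • K}

/-- The circumradius `inf {ρ > 0 : K ⊆ c + ρ B for some c}`. -/
def circumradius (K : Set E) : ℝ :=
  sInf {ρ : ℝ | 0 < ρ ∧ ∃ c : E, K ⊆ Metric.closedBall c ρ}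

/-- `c` is a circumcenter of `K`: the ball around `c` of radius the circumradius contains `K`. -/
def IsCircumcenter (K : Set E) (c : E) : Prop :=
  K ⊆ Metric.closedBall c (circumradius K)

/-- A (diametrically) complete convex body: adding any point increases the diameter. -/
def IsDiamComplete (K : Set E) : Prop :=
  IsConvexBody K ∧ ∀ x : E, x ∉ K → Metric.diam K < Metric.diam (insert x K)

/-- `T` is a completion of `K`: a complete body of the same diameter containing `K`. -/
def IsCompletion (K T : Set E) : Prop :=
  K ⊆ T ∧ IsDiamComplete T ∧ Metric.diam T = Metric.diam K

/-- The pseudo completion of `K` with respect to the circumcenter `c`: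
the convex hull of `K ∪ (c + (D(K) - R(K)) B)`. -/
def pseudoCompletion (K : Set E) (c : E) : Set E :=
  convexHull ℝ (K ∪ Metric.closedBall c (Metric.diam K - circumradius K))

/-- `S` is a `k`-dimensional simplex. -/
def IsSimplex (k : ℕ) (S : Set E) : Prop :=
  ∃ p : Fin (k + 1) → E, AffineIndependent ℝ p ∧ S = convexHull ℝ (Set.range p)

/-- The Helly property of order `k` for translates of `C`: a nonempty family of translates of `C`
has a common point as soon as every subfamily of at most `k + 1` members has one. A family of
translates is given by its set `X` of translation vectors; repetitions do not matter. -/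
def HellyProperty (C : Set E) (k : ℕ) : Prop :=
  ∀ X : Set E, X.Nonempty →
    (∀ J : Finset E, (J : Set E) ⊆ X → J.card ≤ k + 1 → (⋂ x ∈ J, ({x} + C)).Nonempty) →
    (⋂ x ∈ X, ({x} + C)).Nonempty

/-- The Helly dimension of `C`: the smallest positive `k` with the Helly property of order `k`. -/
def hellyDim (C : Set E) : ℕ :=
  sInf {k : ℕ | 0 < k ∧ HellyProperty C k}

variable (E)

/-- The Helly dimension of a normed space: that of its unit ball. -/
def him : ℕ := hellyDim (Metric.closedBall (0 : E) 1)

/-- The set of Minkowski asymmetries of all complete bodies. -/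
def completeAsymmetries : Set ℝ :=
  {s : ℝ | ∃ K : Set E, IsDiamComplete K ∧ asymmetry K = s}

/-- The asymmetry constant of the space: the maximal asymmetry of complete bodies. -/
def asymmetryConstant : ℝ := sSup (completeAsymmetries E)

variable {E}

/-- `s(S) = s(S⁺) = s(S*)` for all completions `S*` of `S`, where `S⁺` is the pseudo completion
of `S` with respect to `c`. -/
def EqualAsymmetries (S : Set E) (c : E) : Prop :=
  asymmetry S = asymmetry (pseudoCompletion S c) ∧
    ∀ T : Set E, IsCompletion S T → asymmetry (pseudoCompletion S c) = asymmetry T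

end MinkowskiSpace

end

/-! Everything reduces to the ratio `R / D`. A complete body lies between concentric balls of radii
`D - R` and `R`, which forces `s = R / (D - R)`, an increasing function of `R / D`
(`asymmetry_of_isDiamComplete`). The pseudo completion obeys the same formula.

With `k = him E`, Helly's property reduces circumradii to `(k + 1)`-tuples, whose centroid gives `R
≤ k / (k + 1) * D`, that is, `s ≤ k`. By compactness some tuple maximizes `R / D`; completing it
keeps `D` and does not decrease `R`, so the maximum is attained.

If the ratio is exactly `k / (k + 1)`, each vertex of the extremal tuple has a functional of norm at
most 1 whose drop to every other vertex is `D` (`exists_facet_functional`). These functionals make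
the tuple affinely independent and cut the simplex out of the affine slice of its pseudo completion.
As a `k`-simplex has asymmetry `k`, equal asymmetries mean exactly the extremal ratio, a condition
free of the circumcenter. -/

namespace MinkowskiSpace

section

variable {E : Type*} [NormedAddCommGroup E]

/-! ### Circumradius and circumcenters -/

lemma circumradius_nonneg (K : Set E) : 0 ≤ circumradius K :=
  Real.sInf_nonneg fun _ h => h.1.le

lemma circumradius_le {K : Set E} {c : E} {ρ : ℝ} (hρ : 0 ≤ ρ)
    (h : K ⊆ Metric.closedBall c ρ) : circumradius K ≤ ρ := by
  refine le_of_forall_pos_le_add fun ε hε => ?_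
  exact csInf_le ⟨0, fun _ h => h.1.le⟩
    ⟨by positivity, c, h.trans (Metric.closedBall_subset_closedBall (by linarith))⟩

lemma circumradius_mono {K L : Set E} (h : K ⊆ L) {c : E} (hc : IsCircumcenter L c) :
    circumradius K ≤ circumradius L :=
  circumradius_le (circumradius_nonneg L) (h.trans hc)

lemma circumradius_eq_zero {K : Set E} (hb : Bornology.IsBounded K) (hne : K.Nonempty)
    (hK : Metric.diam K = 0) : circumradius K = 0 := by
  obtain ⟨x, hx⟩ := hne
  refine le_antisymm (circumradius_le (c := x) le_rfl fun y hy => ?_) (circumradius_nonneg K)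
  rw [Metric.mem_closedBall, ← hK]
  exact Metric.dist_le_diam_of_mem hb hy hx

lemma diam_le_two_mul_circumradius {K : Set E} {c : E} (hc : IsCircumcenter K c) :
    Metric.diam K ≤ 2 * circumradius K :=
  (Metric.diam_mono hc Metric.isBounded_closedBall).trans
    (Metric.diam_closedBall (circumradius_nonneg K))

variable [NormedSpace ℝ E]

/-- Centers for the radii `R + 1 / (n + 1)` stay in a compact ball, and any limit point is a
circumcenter. -/
lemma exists_isCircumcenter [FiniteDimensional ℝ E] {K : Set E} (hK : Bornology.IsBounded K)
    (hne : K.Nonempty) : ∃ c, IsCircumcenter K c := by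
  have := FiniteDimensional.proper ℝ E
  obtain ⟨x₀, hx₀⟩ := hne
  set R := circumradius K with hR
  have hset : {ρ : ℝ | 0 < ρ ∧ ∃ c : E, K ⊆ Metric.closedBall c ρ}.Nonempty := by
    obtain ⟨r, hr, h⟩ := hK.subset_closedBall_lt 0 0
    exact ⟨r, hr, 0, h⟩
  have key : ∀ n : ℕ, ∃ c : E, K ⊆ Metric.closedBall c (R + 1 / ((n : ℝ) + 1)) := by
    intro n
    have hlt : R < R + 1 / ((n : ℝ) + 1) := by
      have : (0 : ℝ) < 1 / ((n : ℝ) + 1) := by positivity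
      linarith
    obtain ⟨ρ, ⟨_, c, hc⟩, h⟩ := exists_lt_of_csInf_lt hset hlt
    exact ⟨c, hc.trans (Metric.closedBall_subset_closedBall h.le)⟩
  choose c hc using key
  have hmem : ∀ n, c n ∈ Metric.closedBall x₀ (R + 1) := by
    intro n
    have h1 := hc n hx₀
    rw [Metric.mem_closedBall, dist_comm] at h1
    have h2 : 1 / ((n : ℝ) + 1) ≤ 1 := by
      rw [div_le_one (by positivity)]
      have : (0 : ℝ) ≤ n := n.cast_nonneg
      linarith
    rw [Metric.mem_closedBall]
    linarith
  obtain ⟨a, _, φ, hφ, hlim⟩ := (isCompact_closedBall x₀ (R + 1)).tendsto_subseq hmem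
  refine ⟨a, fun x hx => ?_⟩
  have h1 : Filter.Tendsto (fun n => dist x (c (φ n))) Filter.atTop (nhds (dist x a)) :=
    tendsto_const_nhds.dist hlim
  have h2 : Filter.Tendsto (fun n => R + 1 / ((φ n : ℝ) + 1)) Filter.atTop (nhds (R + 0)) :=
    tendsto_const_nhds.add
      ((tendsto_one_div_add_atTop_nhds_zero_nat (𝕜 := ℝ)).comp hφ.tendsto_atTop)
  rw [add_zero] at h2
  exact le_of_tendsto_of_tendsto' h1 h2 fun n => hc (φ n) hx

lemma circumradius_convexHull (K : Set E) :
    circumradius (convexHull ℝ K) = circumradius K := by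
  unfold circumradius
  congr 1
  ext ρ
  simp only [Set.mem_ofPred_eq, (convex_closedBall _ _).convexHull_subset_iff]

/-- Transfers a bound on normalized tuples back to arbitrary ones. -/
lemma circumradius_smul_vadd_le {ι : Type*} [FiniteDimensional ℝ E] [Finite ι] [Nonempty ι]
    (x : ι → E) {t : ℝ} (ht : 0 < t) (v : E) :
    ∃ c, Set.range x ⊆
      Metric.closedBall c (t * circumradius (Set.range fun i => t⁻¹ • (x i - v))) := by
  obtain ⟨c, hc⟩ := exists_isCircumcenter (K := Set.range fun i => t⁻¹ • (x i - v))
    (Set.finite_range _).isBounded (Set.range_nonempty _)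
  refine ⟨v + t • c, ?_⟩
  rintro _ ⟨i, rfl⟩
  have h := hc ⟨i, rfl⟩
  rw [Metric.mem_closedBall, dist_eq_norm] at h ⊢
  have : x i - (v + t • c) = t • (t⁻¹ • (x i - v) - c) := by
    rw [smul_sub, smul_smul, mul_inv_cancel₀ ht.ne', one_smul]; abel
  rw [this, norm_smul, Real.norm_of_nonneg ht.le]
  gcongr

/-! ### Complete bodies and completions -/

lemma isDiamComplete_mem {K : Set E} (hK : IsDiamComplete K) {y : E}
    (h : ∀ x ∈ K, dist y x ≤ Metric.diam K) : y ∈ K := by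
  by_contra hy
  have h1 := hK.2 y hy
  refine absurd h1 (not_lt.2 ?_)
  refine Metric.diam_le_of_forall_dist_le Metric.diam_nonneg ?_
  have hb := hK.1.2.1.isBounded
  rintro a (rfl | ha) b (rfl | hb')
  · simp [Metric.diam_nonneg]
  · exact h b hb'
  · rw [dist_comm]; exact h a ha
  · exact Metric.dist_le_diam_of_mem hb ha hb'

/-- Zorn's lemma on sets with mutual distances at most `D`. Closure and convex hull preserve the
diameter, so a maximal set is closed and convex. -/
lemma exists_isCompletion [FiniteDimensional ℝ E] {K : Set E} (hK : Bornology.IsBounded K)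
    (hne : K.Nonempty) : ∃ T, IsCompletion K T := by
  have := FiniteDimensional.proper ℝ E
  set D := Metric.diam K with hD
  have hD0 : 0 ≤ D := Metric.diam_nonneg
  obtain ⟨T, hKT, hT⟩ := zorn_subset_nonempty
    {T : Set E | ∀ x ∈ T, ∀ y ∈ T, dist x y ≤ D}
    (by
      intro C hC hchain _
      refine ⟨⋃₀ C, ?_, fun s hs => Set.subset_sUnion_of_mem hs⟩
      rintro x ⟨s, hs, hx⟩ y ⟨t, ht, hy⟩
      rcases hchain.total hs ht with hst | hts
      · exact hC ht x (hst hx) y hy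
      · exact hC hs x hx y (hts hy))
    K (fun x hx y hy => Metric.dist_le_diam_of_mem hK hx hy)
  have hTne : T.Nonempty := hne.mono hKT
  have hTb : Bornology.IsBounded T := Metric.isBounded_iff.2 ⟨D, fun x hx y hy => hT.1 x hx y hy⟩
  have hTD : Metric.diam T ≤ D := Metric.diam_le_of_forall_dist_le hD0 hT.1
  have hTD' : Metric.diam T = D := le_antisymm hTD (Metric.diam_mono hKT hTb)
  have hmax : ∀ L : Set E, T ⊆ L → Bornology.IsBounded L → Metric.diam L ≤ D → L ⊆ T := by
    intro L hTL hLb hL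
    exact hT.2 (fun x hx y hy => (Metric.dist_le_diam_of_mem hLb hx hy).trans hL) hTL
  refine ⟨T, hKT, ⟨⟨hTne, ?_, ?_⟩, ?_⟩, hTD'⟩
  · have hcl : closure T ⊆ T := hmax _ subset_closure hTb.closure
      (by rw [Metric.diam_closure]; exact hTD)
    exact Metric.isCompact_of_isClosed_isBounded (isClosed_of_closure_subset hcl) hTb
  · have hcv : convexHull ℝ T ⊆ T := hmax _ (subset_convexHull ℝ T) (isBounded_convexHull.2 hTb)
      (by rw [convexHull_diam]; exact hTD)
    rw [← hcv.antisymm (subset_convexHull ℝ T)]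
    exact convex_convexHull ℝ T
  · intro x hx
    by_contra hlt
    rw [not_lt, hTD'] at hlt
    exact hx (hmax _ (Set.subset_insert x T) (Bornology.IsBounded.insert hTb x) hlt
      (Set.mem_insert x T))

/-! ### Jung's bound for `k + 1` points and its equality case -/

lemma norm_sub_sum_smul_le {ι : Type*} [Fintype ι] {x : ι → E} {w : ι → ℝ} {D : ℝ}
    (hx : ∀ i j, dist (x i) (x j) ≤ D) (hw : ∀ i, 0 ≤ w i) (hsum : ∑ i, w i = 1) (i : ι) :
    ‖x i - ∑ j, w j • x j‖ ≤ (1 - w i) * D := by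
  classical
  have h1 : x i - ∑ j, w j • x j = ∑ j ∈ Finset.univ.erase i, w j • (x i - x j) := by
    rw [← Finset.add_sum_erase _ _ (Finset.mem_univ i)]
    rw [← Finset.add_sum_erase _ _ (Finset.mem_univ i)] at hsum
    simp only [smul_sub, Finset.sum_sub_distrib, ← Finset.sum_smul]
    rw [← sub_eq_of_eq_add' hsum.symm, sub_smul, one_smul]; abel
  have h2 : 1 - w i = ∑ j ∈ Finset.univ.erase i, w j := by
    rw [← hsum, ← Finset.add_sum_erase _ _ (Finset.mem_univ i)]; ring
  rw [h1, h2, Finset.sum_mul]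
  refine (norm_sum_le _ _).trans (Finset.sum_le_sum fun j _ => ?_)
  rw [norm_smul, Real.norm_of_nonneg (hw j), ← dist_eq_norm]
  exact mul_le_mul_of_nonneg_left (hx i j) (hw j)

/-- A tuple of `k + 1` points with mutual distances at most `D` lies in the ball of radius `k D / (k + 1)` around its
centroid. -/
lemma range_subset_closedBall_centroid {k : ℕ} {x : Fin (k + 1) → E} {D : ℝ}
    (hx : ∀ i j, dist (x i) (x j) ≤ D) :
    Set.range x ⊆
      Metric.closedBall (∑ j, (1 / ((k : ℝ) + 1)) • x j) ((k : ℝ) / (k + 1) * D) := by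
  have hk : (0 : ℝ) < (k : ℝ) + 1 := by positivity
  rintro _ ⟨i, rfl⟩
  have h := norm_sub_sum_smul_le (w := fun _ => 1 / ((k : ℝ) + 1)) hx
    (fun _ => by positivity) (by simp [hk.ne']) i
  rw [Metric.mem_closedBall, dist_eq_norm]
  refine h.trans_eq ?_
  field_simp
  ring

/-- If the circumradius of `k + 1` points is maximal relative to the diameter, every vertex has a
norming functional that is constant on the opposite facet. -/
lemma exists_facet_functional {k : ℕ} {x : Fin (k + 1) → E} {D : ℝ} (hD : 0 < D)
    (hx : ∀ i j, dist (x i) (x j) ≤ D)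
    (hR : ∀ c ρ, Set.range x ⊆ Metric.closedBall c ρ → (k : ℝ) / (k + 1) * D ≤ ρ)
    (i : Fin (k + 1)) :
    ∃ f : StrongDual ℝ E, ‖f‖ ≤ 1 ∧ ∀ j, j ≠ i → f (x i - x j) = D := by
  classical
  have hk : (0 : ℝ) < (k : ℝ) + 1 := by positivity
  set r : ℝ := (k : ℝ) / (k + 1) * D with hr
  set c : E := ∑ j, (1 / ((k : ℝ) + 1)) • x j with hc
  -- Otherwise push the centroid slightly away from `x i`: the distance to `x i` stays below `r`,
  -- and the bounds for the other vertices drop below `r`, contradicting `hR`.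
  have hnorm : r ≤ ‖x i - c‖ := by
    by_contra hlt
    rw [not_le] at hlt
    obtain ⟨t, ht0, ht1, ht⟩ :
        ∃ t : ℝ, 0 < t ∧ t ≤ 1 / ((k : ℝ) + 1) ∧ (1 + t) * ‖x i - c‖ < r := by
      have hcont : Filter.Tendsto (fun t : ℝ => (1 + t) * ‖x i - c‖) (nhdsWithin 0 (Set.Ioi 0))
          (nhds ((1 + 0) * ‖x i - c‖)) :=
        ((by fun_prop : Continuous fun t : ℝ => (1 + t) * ‖x i - c‖).tendsto 0).mono_left
          nhdsWithin_le_nhds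
      have h1 := hcont.eventually_lt_const (by simpa using hlt)
      have h2 : ∀ᶠ t : ℝ in nhdsWithin 0 (Set.Ioi 0), t ∈ Set.Ioc 0 (1 / ((k : ℝ) + 1)) :=
        Ioc_mem_nhdsGT (by positivity)
      obtain ⟨t, h1, h2⟩ := (h1.and h2).exists
      exact ⟨t, h2.1, h2.2, h1⟩
    -- Barycentric weights of the pushed point `c + t • (c - x i)`; the bound on `t` keeps `w i`
    -- nonnegative.
    set w : Fin (k + 1) → ℝ := fun j => (1 + t) / ((k : ℝ) + 1) - if j = i then t else 0 with hw
    have hw0 : ∀ j, 0 ≤ w j := by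
      intro j
      have h3 : t * ((k : ℝ) + 1) ≤ 1 := by rwa [le_div_iff₀ hk] at ht1
      have h4 : t ≤ (1 + t) / ((k : ℝ) + 1) := by
        rw [le_div_iff₀ hk]; linarith
      simp only [hw]
      split_ifs <;> linarith
    have hw1 : ∑ j, w j = 1 := by
      simp only [hw, Finset.sum_sub_distrib, Finset.sum_ite_eq', Finset.mem_univ, if_true,
        Finset.sum_const, Finset.card_univ, Fintype.card_fin, nsmul_eq_mul]
      push_cast
      field_simp
      ring
    have hcw : ∑ j, w j • x j = c + t • (c - x i) := by
      have h5 : ∀ j, w j • x j =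
          (1 + t) • ((1 / ((k : ℝ) + 1)) • x j) - if j = i then t • x j else 0 := by
        intro j
        simp only [hw, sub_smul, smul_smul]
        congr 1
        · congr 1; ring
        · split_ifs <;> simp
      simp only [h5, Finset.sum_sub_distrib, ← Finset.smul_sum, Finset.sum_ite_eq',
        Finset.mem_univ, if_true, ← hc]
      rw [smul_sub, add_smul, one_smul]; abel
    have hcont := hR (c + t • (c - x i))
      (max ((1 - (1 + t) / ((k : ℝ) + 1)) * D) ((1 + t) * ‖x i - c‖)) (by
        rintro _ ⟨j, rfl⟩
        rw [Metric.mem_closedBall, dist_eq_norm]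
        by_cases hj : j = i
        · subst hj
          refine le_max_of_le_right (le_of_eq ?_)
          have : x j - (c + t • (c - x j)) = (1 + t) • (x j - c) := by
            simp only [smul_sub, add_smul, one_smul]; abel
          rw [this, norm_smul, Real.norm_of_nonneg (by positivity)]
        · refine le_max_of_le_left ?_
          rw [← hcw]
          refine (norm_sub_sum_smul_le hx hw0 hw1 j).trans_eq ?_
          simp [hw, hj])
    refine absurd hcont (not_le.2 (max_lt ?_ ht))
    rw [hr]
    refine mul_lt_mul_of_pos_right ?_ hD
    rw [lt_div_iff₀ hk, sub_mul, div_mul_cancel₀ _ hk.ne']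
    linarith
  obtain ⟨f, hf1, hf⟩ := exists_dual_vector'' ℝ (x i - c)
  have hle : ∀ j, f (x i - x j) ≤ D := by
    intro j
    calc f (x i - x j) ≤ ‖f (x i - x j)‖ := Real.le_norm_self _
      _ ≤ ‖f‖ * ‖x i - x j‖ := f.le_opNorm _
      _ ≤ 1 * D := by
        gcongr
        rw [← dist_eq_norm]; exact hx i j
      _ = D := one_mul D
  refine ⟨f, hf1, fun j hj => le_antisymm (hle j) ?_⟩
  -- The `k` drops are each at most `D` and sum to at least `k * D`, so each equals `D`.
  have hsum : ((k : ℝ) + 1) * f (x i - c) = ∑ l ∈ Finset.univ.erase i, f (x i - x l) := by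
    have h6 : ((k : ℝ) + 1) • (x i - c) = ∑ l, (x i - x l) := by
      rw [hc, ← Finset.smul_sum, smul_sub, smul_smul, mul_one_div_cancel hk.ne', one_smul,
        Finset.sum_sub_distrib]
      simp only [Finset.sum_const, Finset.card_univ, Fintype.card_fin]
      rw [← Nat.cast_smul_eq_nsmul ℝ]
      push_cast
      rfl
    rw [← smul_eq_mul, ← map_smul, h6, map_sum, ← Finset.add_sum_erase _ _ (Finset.mem_univ i)]
    simp
  have hcard : (Finset.univ.erase i).card = k := by simp
  have hge : (k : ℝ) * D ≤ ∑ l ∈ Finset.univ.erase i, f (x i - x l) := by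
    rw [← hsum, hf]
    have : (k : ℝ) * D = ((k : ℝ) + 1) * r := by rw [hr]; field_simp
    rw [this]
    exact mul_le_mul_of_nonneg_left (by simpa using hnorm) hk.le
  by_contra hlt
  rw [not_le] at hlt
  have : ∑ l ∈ Finset.univ.erase i, f (x i - x l) < ∑ l ∈ Finset.univ.erase i, D :=
    Finset.sum_lt_sum (fun l _ => hle l) ⟨j, by simp [hj], hlt⟩
  rw [Finset.sum_const, hcard, nsmul_eq_mul] at this
  linarith

/-! ### Helly dimension and extremal tuples -/

lemma hellyProperty_of_finrank_le [FiniteDimensional ℝ E] {C : Set E} (hC : IsCompact C)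
    (hC' : Convex ℝ C) {k : ℕ} (hk : Module.finrank ℝ E ≤ k) : HellyProperty C k := by
  classical
  intro X _ h
  have key := Convex.helly_theorem_compact' (𝕜 := ℝ) (F := fun x : X => {(x : E)} + C)
    (fun x => (convex_singleton _).add hC') (fun x => isCompact_singleton.add hC) (by
      intro I hI
      have := h (I.image Subtype.val) (by simp)
        (Finset.card_image_le.trans (hI.trans (by omega)))
      simpa using this)
  simpa using key

variable (E) in
lemma him_spec [FiniteDimensional ℝ E] :
    0 < him E ∧ HellyProperty (Metric.closedBall (0 : E) 1) (him E) := by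
  have := FiniteDimensional.proper ℝ E
  refine Nat.sInf_mem (s := {k | 0 < k ∧ HellyProperty (Metric.closedBall (0 : E) 1) k})
    ⟨max 1 (Module.finrank ℝ E), by simp, ?_⟩
  exact hellyProperty_of_finrank_le (isCompact_closedBall _ _) (convex_closedBall _ _)
    (le_max_right _ _)

lemma exists_tuple_range_eq {α : Type*} {k : ℕ} {J : Finset α} (hne : J.Nonempty)
    (hJ : J.card ≤ k + 1) : ∃ x : Fin (k + 1) → α, Set.range x = J := by
  have : Nonempty J := hne.to_subtype
  obtain ⟨e⟩ : Nonempty (J ↪ Fin (k + 1)) := Function.Embedding.nonempty_of_card_le (by simpa)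
  refine ⟨fun i => (Function.invFun e i : J), ?_⟩
  have := (Function.invFun_surjective e.injective).range_eq
  rw [show (fun i => ((Function.invFun e i : J) : α)) = Subtype.val ∘ Function.invFun e from rfl,
    Set.range_comp, this]
  simp

/-- A set lies in a ball of radius `ρ` as soon as all its `(k + 1)`-tuples do, where `k` is the
Helly dimension. -/
lemma exists_subset_closedBall_of_tuples [FiniteDimensional ℝ E] {K : Set E} (hne : K.Nonempty)
    {ρ : ℝ} (hρ : 0 < ρ)
    (h : ∀ x : Fin (him E + 1) → E, (∀ i, x i ∈ K) → ∃ c, Set.range x ⊆ Metric.closedBall c ρ) :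
    ∃ c, K ⊆ Metric.closedBall c ρ := by
  classical
  -- Centers and points swap roles: a common point of the unit balls around `ρ⁻¹ • x` is, scaled by
  -- `ρ`, the center of a ball of radius `ρ` containing all `x`.
  have mem_iff : ∀ x y : E, y ∈ {ρ⁻¹ • x} + Metric.closedBall (0 : E) 1 ↔
      x ∈ Metric.closedBall (ρ • y) ρ := by
    intro x y
    rw [singleton_add_closedBall, Metric.mem_closedBall, Metric.mem_closedBall, dist_comm x,
      dist_eq_norm, dist_eq_norm,
      show ρ • y - x = ρ • (y - (ρ⁻¹ • x + 0)) by
        rw [add_zero, smul_sub, smul_smul, mul_inv_cancel₀ hρ.ne', one_smul],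
      norm_smul, Real.norm_of_nonneg hρ.le]
    constructor
    · intro h; nlinarith
    · intro h; by_contra hlt; nlinarith
  obtain ⟨y, hy⟩ := (him_spec E).2 ((fun x => ρ⁻¹ • x) '' K) (hne.image _) (by
    intro J hJ hcard
    rcases J.eq_empty_or_nonempty with rfl | hJne
    · simp
    · obtain ⟨x, hx⟩ := exists_tuple_range_eq hJne hcard
      have hxK : ∀ i, ρ • x i ∈ K := by
        intro i
        have : x i ∈ (J : Set E) := hx ▸ Set.mem_range_self i
        obtain ⟨z, hz, hzx⟩ := hJ this
        rw [← hzx]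
        simpa [smul_smul, mul_inv_cancel₀ hρ.ne'] using hz
      obtain ⟨c, hc⟩ := h (fun i => ρ • x i) hxK
      refine ⟨ρ⁻¹ • c, ?_⟩
      simp only [Set.mem_iInter]
      intro z hz
      rw [← Finset.mem_coe, ← hx] at hz
      obtain ⟨i, rfl⟩ := hz
      have := (mem_iff (ρ • x i) (ρ⁻¹ • c)).2
        (by rw [smul_smul, mul_inv_cancel₀ hρ.ne', one_smul]; exact hc ⟨i, rfl⟩)
      rwa [smul_smul, inv_mul_cancel₀ hρ.ne', one_smul] at this)
  refine ⟨ρ • y, fun x hx => (mem_iff x y).1 ?_⟩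
  simp only [Set.mem_iInter] at hy
  exact hy _ ⟨x, hx, rfl⟩

lemma circumradius_le_him [FiniteDimensional ℝ E] {K : Set E} (hb : Bornology.IsBounded K)
    (hne : K.Nonempty) :
    circumradius K ≤ (him E : ℝ) / (him E + 1) * Metric.diam K := by
  have hk : (0 : ℝ) < him E := by exact_mod_cast (him_spec E).1
  rcases (Metric.diam_nonneg (s := K)).eq_or_lt with h0 | hpos
  · rw [circumradius_eq_zero hb hne h0.symm, ← h0, mul_zero]
  · obtain ⟨c, hc⟩ := exists_subset_closedBall_of_tuples hne
      (ρ := (him E : ℝ) / (him E + 1) * Metric.diam K) (by positivity)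
      (fun x hx => ⟨_, range_subset_closedBall_centroid
        fun i j => Metric.dist_le_diam_of_mem hb (hx i) (hx j)⟩)
    exact circumradius_le (by positivity) hc

lemma circumradius_lt_diam [FiniteDimensional ℝ E] {K : Set E} (hb : Bornology.IsBounded K)
    (hne : K.Nonempty) (hpos : 0 < Metric.diam K) : circumradius K < Metric.diam K := by
  refine (circumradius_le_him hb hne).trans_lt (mul_lt_of_lt_one_left hpos ?_)
  rw [div_lt_one (by positivity)]
  linarith

/-- Among all bounded sets, the ratio of circumradius and diameter is maximized by a tuple of
`him E + 1` points. -/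
lemma exists_tuple_max_circumradius (E : Type*) [NormedAddCommGroup E] [NormedSpace ℝ E]
    [FiniteDimensional ℝ E] [Nontrivial E] :
    ∃ x : Fin (him E + 1) → E, 0 < Metric.diam (Set.range x) ∧
      ∀ K : Set E, Bornology.IsBounded K → K.Nonempty →
        circumradius K * Metric.diam (Set.range x) ≤
          circumradius (Set.range x) * Metric.diam K := by
  have := FiniteDimensional.proper ℝ E
  set k := him E with hk
  have hkpos : 0 < k := (him_spec E).1
  set C : Set (Fin (k + 1) → E) := {x | x 0 = 0 ∧ ∀ i j, dist (x i) (x j) ≤ 1} with hC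
  have hRb : ∀ x : Fin (k + 1) → E, Bornology.IsBounded (Set.range x) :=
    fun x => (Set.finite_range x).isBounded
  have hCc : IsCompact C := by
    refine Metric.isCompact_of_isClosed_isBounded ?_ ?_
    · have hCeq : C = {x | x 0 = 0} ∩ ⋂ i, ⋂ j, {x | dist (x i) (x j) ≤ 1} := by
        ext; simp [hC]
      rw [hCeq]
      refine IsClosed.inter (isClosed_eq (by fun_prop) (by fun_prop)) ?_
      exact isClosed_iInter fun i => isClosed_iInter fun j =>
        isClosed_le (by fun_prop) (by fun_prop)
    · refine Metric.isBounded_closedBall (x := (0 : Fin (k + 1) → E)) (r := 1) |>.subset ?_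
      rintro x ⟨h0, hx⟩
      rw [Metric.mem_closedBall, dist_pi_le_iff zero_le_one]
      intro i
      have := hx i 0
      rwa [h0] at this
  have hRle : ∀ x y : Fin (k + 1) → E,
      circumradius (Set.range x) ≤ circumradius (Set.range y) + dist x y := by
    intro x y
    obtain ⟨c, hc⟩ := exists_isCircumcenter (hRb y) (Set.range_nonempty _)
    refine circumradius_le (c := c) (add_nonneg (circumradius_nonneg _) dist_nonneg) ?_
    rintro _ ⟨i, rfl⟩
    have h1 := hc ⟨i, rfl⟩
    have h2 := dist_le_pi_dist x y i
    rw [Metric.mem_closedBall] at h1 ⊢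
    linarith [dist_triangle (x i) (y i) c]
  have hcont : Continuous fun x : Fin (k + 1) → E => circumradius (Set.range x) := by
    exact (LipschitzWith.of_le_add hRle).continuous
  obtain ⟨x, hxC, hmax⟩ := hCc.exists_isMaxOn ⟨0, by simp [hC]⟩ hcont.continuousOn
  have hmax' : ∀ y ∈ C, circumradius (Set.range y) ≤ circumradius (Set.range x) := hmax
  have hdiam : Metric.diam (Set.range x) ≤ 1 := by
    refine Metric.diam_le_of_forall_dist_le zero_le_one ?_
    rintro _ ⟨i, rfl⟩ _ ⟨j, rfl⟩
    exact hxC.2 i j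
  set ρ := circumradius (Set.range x) with hρ
  have hρpos : 0 < ρ := by
    -- Two points at distance 1, padded to a tuple, have positive circumradius.
    obtain ⟨v, hv⟩ := exists_norm_eq E (zero_le_one (α := ℝ))
    set y : Fin (k + 1) → E := fun i => if i = 0 then 0 else v with hy
    have hyC : y ∈ C := by
      refine ⟨by simp [hy], fun i j => ?_⟩
      simp only [hy]
      split_ifs <;> simp [hv]
    have h1 := hmax' y hyC
    obtain ⟨c, hc⟩ := exists_isCircumcenter (hRb y) (Set.range_nonempty _)
    have h2 := diam_le_two_mul_circumradius hc
    have h3 : dist (y 0) (y (Fin.last k)) ≤ Metric.diam (Set.range y) :=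
      Metric.dist_le_diam_of_mem (hRb y) ⟨_, rfl⟩ ⟨_, rfl⟩
    have h4 : dist (y 0) (y (Fin.last k)) = 1 := by
      have : Fin.last k ≠ 0 := by
        rw [Ne, Fin.ext_iff]; simp; omega
      simp [hy, this, hv]
    linarith
  have hscale : ∀ K : Set E, Bornology.IsBounded K → K.Nonempty →
      circumradius K ≤ ρ * Metric.diam K := by
    intro K hb hne
    rcases (Metric.diam_nonneg (s := K)).eq_or_lt with h0 | hpos
    · rw [circumradius_eq_zero hb hne h0.symm, ← h0, mul_zero]
    obtain ⟨c, hc⟩ := exists_subset_closedBall_of_tuples hne (mul_pos hρpos hpos) (by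
      intro y hy
      obtain ⟨c, hc⟩ := circumradius_smul_vadd_le y hpos (y 0)
      refine ⟨c, hc.trans (Metric.closedBall_subset_closedBall ?_)⟩
      rw [mul_comm]
      refine mul_le_mul_of_nonneg_right (hmax' _ ⟨by simp, fun i j => ?_⟩) hpos.le
      rw [dist_smul₀, dist_sub_right, norm_inv, Real.norm_of_nonneg hpos.le,
        inv_mul_le_one₀ hpos]
      exact Metric.dist_le_diam_of_mem hb (hy i) (hy j))
    exact circumradius_le (by positivity) hc
  refine ⟨x, ?_, fun K hb hne => ?_⟩
  · refine lt_of_le_of_ne Metric.diam_nonneg fun h => hρpos.ne' ?_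
    exact circumradius_eq_zero (hRb x) (Set.range_nonempty _) h.symm
  -- Only diameter at most 1 is known for the maximizer, and it suffices here.
  · refine (mul_le_of_le_one_right (circumradius_nonneg K) hdiam).trans (hscale K hb hne)

/-! ### Asymmetry of complete bodies -/

/-- The inequality `R(K) ≤ s(K) / (s(K) + 1) * D(K)`, for admissible dilation factors. -/
lemma circumradius_le_of_neg_subset {K : Set E} (hb : Bornology.IsBounded K) {ρ : ℝ}
    (hρ : 0 < ρ) {c : E} (h : -K ⊆ {c} + ρ • K) :
    (ρ + 1) * circumradius K ≤ ρ * Metric.diam K := by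
  rw [← le_div_iff₀' (by positivity)]
  -- The center is the fixed point of `x ↦ -ρ • x - c`: from `-x = c + ρ • y` its difference to `x`
  -- is `ρ / (ρ + 1)` times `x - y`.
  refine circumradius_le (c := -((ρ + 1)⁻¹ • c)) (by positivity) fun x hx => ?_
  obtain ⟨_, hc', _, ⟨y, hy, rfl⟩, hxy⟩ := h (Set.neg_mem_neg.2 hx)
  rw [Set.mem_singleton_iff] at hc'
  have hd := Metric.dist_le_diam_of_mem hb hx hy
  have hρ1 : ρ + 1 ≠ 0 := by positivity
  have h1 : x - -((ρ + 1)⁻¹ • c) = (ρ / (ρ + 1)) • (x - y) := by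
    have hxy' : c = -x - ρ • y := by rw [← hxy, hc']; simp
    rw [hxy', div_eq_inv_mul, mul_smul, ← smul_right_injective E hρ1 |>.eq_iff]
    simp only [smul_sub, smul_neg, smul_smul, mul_inv_cancel_left₀ hρ1]
    simp only [mul_inv_cancel₀ hρ1]
    module
  rw [Metric.mem_closedBall, dist_eq_norm, h1, norm_smul, ← dist_eq_norm,
    Real.norm_of_nonneg (by positivity), div_mul_eq_mul_div]
  gcongr

/-- Dilating the inner ball by `R / (D - R)` gives a ball of radius `R`, which covers a translate of
`-K`; `circumradius_le_of_neg_subset` excludes smaller factors. -/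
lemma asymmetry_eq_of_closedBall {K : Set E} (hb : Bornology.IsBounded K) {c : E}
    (h1 : Metric.closedBall c (Metric.diam K - circumradius K) ⊆ K)
    (h2 : IsCircumcenter K c) (hR : 0 < circumradius K) (hD : circumradius K < Metric.diam K) :
    asymmetry K = circumradius K / (Metric.diam K - circumradius K) := by
  set R := circumradius K
  set D := Metric.diam K
  have hDR : 0 < D - R := by linarith
  refine IsLeast.csInf_eq ⟨⟨by positivity, -c - (R / (D - R)) • c, ?_⟩, ?_⟩
  · intro x hx
    have hx' := h2 (Set.mem_neg.1 hx)
    rw [Metric.mem_closedBall, dist_eq_norm] at hx'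
    have hρ : R / (D - R) ≠ 0 := by positivity
    refine ⟨_, rfl, _, ⟨c + (R / (D - R))⁻¹ • (x + c), h1 ?_, rfl⟩, ?_⟩
    · rw [Metric.mem_closedBall, dist_eq_norm, add_sub_cancel_left, norm_smul, norm_inv,
        Real.norm_of_nonneg (by positivity), inv_div, div_mul_eq_mul_div, div_le_iff₀ hR]
      have : ‖x + c‖ = ‖-x - c‖ := by rw [← norm_neg]; congr 1; abel
      rw [this]
      gcongr
    · simp only [smul_add, smul_smul, mul_inv_cancel₀ hρ]
      module
  · rintro ρ ⟨hρ, c', hc'⟩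
    have := circumradius_le_of_neg_subset hb hρ hc'
    rw [div_le_iff₀ hDR]
    change (ρ + 1) * R ≤ ρ * D at this
    linarith

lemma asymmetry_singleton (x : E) : asymmetry ({x} : Set E) = 0 := by
  have : {ρ : ℝ | 0 < ρ ∧ ∃ c : E, -({x} : Set E) ⊆ {c} + ρ • {x}} = Set.Ioi 0 := by
    ext ρ
    refine ⟨fun h => h.1, fun h => ⟨h, -x - ρ • x, ?_⟩⟩
    simp
  rw [asymmetry, this, csInf_Ioi]

lemma asymmetry_of_isDiamComplete [FiniteDimensional ℝ E] {K : Set E} (hK : IsDiamComplete K) :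
    asymmetry K = circumradius K / (Metric.diam K - circumradius K) := by
  have hb := hK.1.2.1.isBounded
  have hne := hK.1.1
  -- For a single point the formula reads `0 / 0 = 0`.
  rcases (Metric.diam_nonneg (s := K)).eq_or_lt with h0 | hpos
  · rw [circumradius_eq_zero hb hne h0.symm, zero_div]
    obtain ⟨x, hx⟩ := hne
    have : K = {x} := by
      refine Set.eq_singleton_iff_unique_mem.2 ⟨hx, fun y hy => ?_⟩
      refine dist_le_zero.1 ?_
      rw [h0]
      exact Metric.dist_le_diam_of_mem hb hy hx
    rw [this, asymmetry_singleton]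
  · obtain ⟨c, hc⟩ := exists_isCircumcenter hb hne
    have h2 := diam_le_two_mul_circumradius hc
    refine asymmetry_eq_of_closedBall hb (fun y hy => isDiamComplete_mem hK fun x hx => ?_) hc
      (by linarith) (circumradius_lt_diam hb hne hpos)
    have h3 := hc hx
    rw [Metric.mem_closedBall] at hy h3
    have := dist_triangle_right y x c
    linarith

/-! ### Pseudo completions -/

lemma pseudoCompletion_subset_closedBall {K : Set E} {c : E} (hc : IsCircumcenter K c) :
    pseudoCompletion K c ⊆ Metric.closedBall c (circumradius K) := by
  refine convexHull_min (Set.union_subset hc (Metric.closedBall_subset_closedBall ?_))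
    (convex_closedBall _ _)
  linarith [diam_le_two_mul_circumradius hc]

lemma subset_pseudoCompletion (K : Set E) (c : E) : K ⊆ pseudoCompletion K c :=
  Set.subset_union_left.trans (subset_convexHull ℝ _)

lemma circumradius_pseudoCompletion {K : Set E} {c : E} (hc : IsCircumcenter K c) :
    circumradius (pseudoCompletion K c) = circumradius K := by
  have h := circumradius_le (circumradius_nonneg K) (pseudoCompletion_subset_closedBall hc)
  refine le_antisymm h ?_
  unfold circumradius
  refine csInf_le_csInf ⟨0, fun _ h => h.1.le⟩ ?_ ?_
  · exact ⟨circumradius K + 1, by linarith [circumradius_nonneg K], c,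
      (pseudoCompletion_subset_closedBall hc).trans
        (Metric.closedBall_subset_closedBall (by linarith))⟩
  · rintro ρ ⟨hρ, c', hc'⟩
    exact ⟨hρ, c', (subset_pseudoCompletion K c).trans hc'⟩

lemma isBounded_pseudoCompletion {K : Set E} {c : E} (hc : IsCircumcenter K c) :
    Bornology.IsBounded (pseudoCompletion K c) :=
  Metric.isBounded_closedBall.subset (pseudoCompletion_subset_closedBall hc)

lemma diam_pseudoCompletion {K : Set E} {c : E} (hc : IsCircumcenter K c) :
    Metric.diam (pseudoCompletion K c) = Metric.diam K := by
  refine le_antisymm ?_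
    (Metric.diam_mono (subset_pseudoCompletion K c) (isBounded_pseudoCompletion hc))
  have hb : Bornology.IsBounded K := Metric.isBounded_closedBall.subset hc
  have h2 := diam_le_two_mul_circumradius hc
  rw [pseudoCompletion, convexHull_diam]
  refine Metric.diam_le_of_forall_dist_le Metric.diam_nonneg ?_
  rintro x (hx | hx) y (hy | hy)
  · exact Metric.dist_le_diam_of_mem hb hx hy
  · have hx' := hc hx
    rw [Metric.mem_closedBall] at hx' hy
    linarith [dist_triangle_right x y c]
  · have hy' := hc hy
    rw [Metric.mem_closedBall] at hx hy'
    linarith [dist_triangle_right x y c]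
  · rw [Metric.mem_closedBall] at hx hy
    linarith [dist_triangle_right x y c]

lemma asymmetry_pseudoCompletion [FiniteDimensional ℝ E] {K : Set E} {c : E}
    (hc : IsCircumcenter K c) (hne : K.Nonempty) (hpos : 0 < Metric.diam K) :
    asymmetry (pseudoCompletion K c) = circumradius K / (Metric.diam K - circumradius K) := by
  have hb : Bornology.IsBounded K := Metric.isBounded_closedBall.subset hc
  have hD := diam_pseudoCompletion hc
  have hR := circumradius_pseudoCompletion hc
  have h2 := diam_le_two_mul_circumradius hc
  rw [← hD, ← hR]
  refine asymmetry_eq_of_closedBall (c := c) (isBounded_pseudoCompletion hc) ?_ ?_ ?_ ?_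
  · rw [hD, hR]
    exact Set.subset_union_right.trans (subset_convexHull ℝ _)
  · rw [IsCircumcenter, hR]
    exact pseudoCompletion_subset_closedBall hc
  · rw [hR]; linarith
  · rw [hR, hD]; exact circumradius_lt_diam hb hne hpos

/-! ### Simplices and facet functionals -/

lemma mem_convexHull_range_iff {ι : Type*} [Fintype ι] {x : ι → E} {y : E} :
    y ∈ convexHull ℝ (Set.range x) ↔
      ∃ w : ι → ℝ, (∀ i, 0 ≤ w i) ∧ ∑ i, w i = 1 ∧ ∑ i, w i • x i = y := by
  constructor
  · intro hy
    rw [convexHull_range_eq_exists_affineCombination] at hy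
    obtain ⟨s, w, hw0, hw1, rfl⟩ := hy
    classical
    refine ⟨fun i => if i ∈ s then w i else 0, fun i => ?_, ?_, ?_⟩
    · dsimp only
      split_ifs with hi
      exacts [hw0 i hi, le_rfl]
    · simpa using hw1
    · rw [Finset.affineCombination_eq_linear_combination _ _ _ hw1]
      simp [ite_smul]
  · rintro ⟨w, hw0, hw1, rfl⟩
    exact (convex_convexHull ℝ _).sum_mem (fun i _ => hw0 i) hw1
      fun i _ => subset_convexHull ℝ _ ⟨i, rfl⟩

lemma asymmetry_of_isSimplex {k : ℕ} (hk : 0 < k) {S : Set E} (hS : IsSimplex k S) :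
    asymmetry S = k := by
  classical
  obtain ⟨x, hx, rfl⟩ := hS
  have hk' : (0 : ℝ) < k := by exact_mod_cast hk
  set g : E := ∑ j, x j with hg
  refine IsLeast.csInf_eq ⟨⟨hk', -g, ?_⟩, ?_⟩
  · have hconv : Convex ℝ ({-g} + (k : ℝ) • convexHull ℝ (Set.range x)) :=
      (convex_singleton _).add ((convex_convexHull ℝ _).smul _)
    rw [← Set.neg_subset_neg, neg_neg]
    refine convexHull_min ?_ hconv.neg
    rintro _ ⟨i, rfl⟩
    rw [Set.mem_neg]
    -- The centroid of the facet opposite `x i`.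
    refine ⟨_, rfl, _, ⟨(k : ℝ)⁻¹ • (g - x i), ?_, rfl⟩, ?_⟩
    · rw [mem_convexHull_range_iff]
      refine ⟨fun j => if j = i then 0 else (k : ℝ)⁻¹, fun j => ?_, ?_, ?_⟩
      · dsimp only
        split_ifs <;> positivity
      · rw [← Finset.add_sum_erase _ _ (Finset.mem_univ i)]
        rw [if_pos rfl, zero_add, Finset.sum_congr rfl
          (g := fun _ => (k : ℝ)⁻¹) (fun j hj => if_neg (Finset.ne_of_mem_erase hj))]
        simp [hk'.ne']
      · rw [hg, ← Finset.add_sum_erase _ _ (Finset.mem_univ i),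
          ← Finset.add_sum_erase _ x (Finset.mem_univ i), add_sub_cancel_left, Finset.smul_sum]
        beta_reduce
        rw [if_pos rfl, zero_smul, zero_add]
        exact Finset.sum_congr rfl fun j hj => by rw [if_neg (Finset.ne_of_mem_erase hj)]
    · simp only [smul_smul, mul_inv_cancel₀ hk'.ne', one_smul]
      abel
  · rintro ρ ⟨hρ, c, hc⟩
    have key : ∀ i, ∃ w : Fin (k + 1) → ℝ, (∀ j, 0 ≤ w j) ∧ ∑ j, w j = 1 ∧
        -x i = c + ρ • ∑ j, w j • x j := by
      intro i
      obtain ⟨_, hc', _, ⟨y, hy, rfl⟩, hxy⟩ :=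
        hc (Set.neg_mem_neg.2 (subset_convexHull ℝ _ ⟨i, rfl⟩))
      rw [Set.mem_singleton_iff] at hc'
      obtain ⟨w, hw0, hw1, rfl⟩ := mem_convexHull_range_iff.1 hy
      exact ⟨w, hw0, hw1, by rw [← hxy, hc']⟩
    choose w hw0 hw1 hw using key
    -- Each `i` yields coefficients representing `-c` with total `ρ + 1`. By affine independence
    -- they agree, so choosing `i = j` makes the `j`-th at least 1; summing gives `ρ + 1 ≥ k + 1`.
    have hcoef : ∀ i l j, ρ * w i j + (if j = i then 1 else 0) =
        ρ * w l j + (if j = l then 1 else 0) := by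
      intro i l j
      have h := affineIndependent_iff.1 hx Finset.univ
        (fun j => (ρ * w i j + (if j = i then 1 else 0)) - (ρ * w l j + (if j = l then 1 else 0)))
        (by simp [Finset.sum_sub_distrib, Finset.sum_add_distrib, ← Finset.mul_sum, hw1])
        (by
          have hcomb : ∀ i, ∑ j, (ρ * w i j + (if j = i then (1 : ℝ) else 0)) • x j = -c := by
            intro i
            simp only [add_smul, mul_smul, Finset.sum_add_distrib, ← Finset.smul_sum, ite_smul,
              one_smul, zero_smul, Finset.sum_ite_eq', Finset.mem_univ, if_true]
            rw [eq_sub_of_add_eq (hw i).symm]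
            abel
          simp only [sub_smul, Finset.sum_sub_distrib, hcomb, sub_self])
        j (Finset.mem_univ j)
      exact sub_eq_zero.1 h
    have hge : ∀ j, 1 ≤ ρ * w 0 j + (if j = 0 then 1 else 0) := by
      intro j
      rw [hcoef 0 j j, if_pos rfl]
      have := mul_nonneg hρ.le (hw0 j j)
      linarith
    have hsum := Finset.sum_le_sum fun j (_ : j ∈ Finset.univ) => hge j
    rw [Finset.sum_add_distrib, ← Finset.mul_sum, hw1] at hsum
    simp at hsum
    linarith

/-- Applied to an affine relation, the functional of vertex `i` shows that the other coefficients
sum to zero, so the `i`-th vanishes. -/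
lemma affineIndependent_of_facet_functional {k : ℕ} {x : Fin (k + 1) → E} {D : ℝ} (hD : 0 < D)
    (h : ∀ i, ∃ f : StrongDual ℝ E, ‖f‖ ≤ 1 ∧ ∀ j, j ≠ i → f (x i - x j) = D) :
    AffineIndependent ℝ x := by
  classical
  rw [affineIndependent_iff]
  intro s w hw hwx i hi
  obtain ⟨f, -, hf⟩ := h i
  have h1 : ∑ j ∈ s, w j * f (x i - x j) = 0 := by
    have : ∑ j ∈ s, w j • (x i - x j) = 0 := by
      simp only [smul_sub, Finset.sum_sub_distrib, ← Finset.sum_smul, hw, hwx]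
      simp
    have := congrArg f this
    simpa only [map_sum, map_smul, smul_eq_mul, map_zero] using this
  have h2 : ∀ j ∈ s.erase i, w j * f (x i - x j) = w j * D :=
    fun j hj => by rw [hf j (Finset.ne_of_mem_erase hj)]
  rw [← Finset.add_sum_erase _ _ hi, Finset.sum_congr rfl h2, ← Finset.sum_mul] at h1
  rw [← Finset.add_sum_erase _ _ hi] at hw
  rw [eq_neg_of_add_eq_zero_right hw, sub_self, map_zero, mul_zero, zero_add] at h1
  rcases mul_eq_zero.1 h1 with h3 | h3
  · linarith
  · exact absurd h3 hD.ne'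

/-- On the pseudo completion `f` drops by at most `D` below `f (x i)`; for the ball part the bound
is `R + (D - R)`. On the affine span the drop is `(1 - w i) * D`, hence `w i ≥ 0`. -/
lemma pseudoCompletion_inter_affineSpan_subset {k : ℕ} {x : Fin (k + 1) → E}
    (hpos : 0 < Metric.diam (convexHull ℝ (Set.range x)))
    (h : ∀ i, ∃ f : StrongDual ℝ E, ‖f‖ ≤ 1 ∧
      ∀ j, j ≠ i → f (x i - x j) = Metric.diam (convexHull ℝ (Set.range x)))
    {c : E} (hc : IsCircumcenter (convexHull ℝ (Set.range x)) c) :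
    pseudoCompletion (convexHull ℝ (Set.range x)) c ∩
      (affineSpan ℝ (convexHull ℝ (Set.range x)) : Set E) ⊆ convexHull ℝ (Set.range x) := by
  classical
  set S := convexHull ℝ (Set.range x) with hS
  set D := Metric.diam S with hD
  rintro y ⟨hy, hyaff⟩
  rw [hS, affineSpan_convexHull] at hyaff
  obtain ⟨w, hw1, rfl⟩ := eq_affineCombination_of_mem_affineSpan_of_fintype hyaff
  rw [Finset.affineCombination_eq_linear_combination _ _ _ hw1] at hy ⊢
  refine mem_convexHull_range_iff.2 ⟨w, fun i => ?_, hw1, rfl⟩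
  obtain ⟨f, hf1, hf⟩ := h i
  have hfle : ∀ z, f z ≤ ‖z‖ := by
    intro z
    calc f z ≤ ‖f z‖ := Real.le_norm_self _
      _ ≤ ‖f‖ * ‖z‖ := f.le_opNorm z
      _ ≤ 1 * ‖z‖ := by gcongr
      _ = ‖z‖ := one_mul _
  have hb : Bornology.IsBounded S := Metric.isBounded_closedBall.subset hc
  have hxi : x i ∈ S := subset_convexHull ℝ _ ⟨i, rfl⟩
  have hhalf : pseudoCompletion S c ⊆ {z | f (x i) - D ≤ f z} := by
    refine convexHull_min (Set.union_subset ?_ ?_)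
      (convex_halfSpace_ge f.toLinearMap.isLinear _)
    · intro z hz
      have h1 := hfle (x i - z)
      have h2 := Metric.dist_le_diam_of_mem hb hxi hz
      rw [dist_eq_norm] at h2
      rw [map_sub] at h1
      change f (x i) - D ≤ f z
      linarith
    · intro z hz
      have h1 := hfle (x i - c)
      have h2 := hfle (c - z)
      have h3 := hc hxi
      rw [Metric.mem_closedBall, dist_eq_norm] at hz h3
      rw [norm_sub_rev] at hz
      rw [map_sub] at h1 h2
      change f (x i) - D ≤ f z
      linarith
  have h1 : f (x i) - D ≤ f (∑ j, w j • x j) := hhalf hy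
  have h2 : f (x i) - f (∑ j, w j • x j) = (1 - w i) * D := by
    have h3 : x i - ∑ j, w j • x j = ∑ j, w j • (x i - x j) := by
      simp only [smul_sub, Finset.sum_sub_distrib, ← Finset.sum_smul, hw1, one_smul]
    rw [← map_sub, h3, map_sum, ← Finset.add_sum_erase _ _ (Finset.mem_univ i)]
    rw [← Finset.add_sum_erase _ _ (Finset.mem_univ i)] at hw1
    rw [sub_self, smul_zero, map_zero, zero_add, ← hw1, add_sub_cancel_left, Finset.sum_mul]
    exact Finset.sum_congr rfl fun j hj => by
      rw [map_smul, hf j (Finset.ne_of_mem_erase hj), smul_eq_mul]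
  nlinarith

lemma div_sub_le_div_sub {R D R' D' : ℝ} (h : R < D) (h' : R' < D') (hle : R * D' ≤ R' * D) :
    R / (D - R) ≤ R' / (D' - R') := by
  rw [div_le_div_iff₀ (by linarith) (by linarith)]
  linarith

lemma div_sub_eq_natCast_iff {R D : ℝ} (k : ℕ) (h : R < D) :
    R / (D - R) = k ↔ R = (k : ℝ) / (k + 1) * D := by
  have hk : (0 : ℝ) < (k : ℝ) + 1 := by positivity
  rw [div_eq_iff (by linarith), div_mul_eq_mul_div, eq_div_iff hk.ne']
  constructor <;> intro h <;> linarith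

lemma diam_pos_of_isSimplex {k : ℕ} (hk : 0 < k) {S : Set E} (hS : IsSimplex k S) :
    0 < Metric.diam S := by
  obtain ⟨x, hx, rfl⟩ := hS
  have hne : x 0 ≠ x (Fin.last k) := fun h => by
    have := congrArg Fin.val (hx.injective h)
    simp at this
    omega
  refine (dist_pos.2 hne).trans_le (Metric.dist_le_diam_of_mem ?_
    (subset_convexHull ℝ _ ⟨_, rfl⟩) (subset_convexHull ℝ _ ⟨_, rfl⟩))
  exact isBounded_convexHull.2 (Set.finite_range x).isBounded

lemma isBounded_of_isSimplex {k : ℕ} {S : Set E} (hS : IsSimplex k S) :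
    Bornology.IsBounded S ∧ S.Nonempty := by
  obtain ⟨x, -, rfl⟩ := hS
  exact ⟨isBounded_convexHull.2 (Set.finite_range x).isBounded, (Set.range_nonempty x).convexHull⟩

lemma exists_facet_functional_of_circumradius_eq {x : Fin (him E + 1) → E}
    (hpos : 0 < Metric.diam (Set.range x))
    (h : circumradius (Set.range x) = (him E : ℝ) / (him E + 1) * Metric.diam (Set.range x))
    (i : Fin (him E + 1)) :
    ∃ f : StrongDual ℝ E, ‖f‖ ≤ 1 ∧ ∀ j, j ≠ i → f (x i - x j) = Metric.diam (Set.range x) := by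
  refine exists_facet_functional hpos (fun i j => Metric.dist_le_diam_of_mem
    (Set.finite_range x).isBounded ⟨i, rfl⟩ ⟨j, rfl⟩) (fun c ρ hc => ?_) i
  rw [← h]
  exact circumradius_le (dist_nonneg.trans (hc ⟨i, rfl⟩)) hc

variable [FiniteDimensional ℝ E]

/-! ### The asymmetry constant and the equality case -/

lemma asymmetry_le_him {K : Set E} (hK : IsDiamComplete K) : asymmetry K ≤ him E := by
  rw [asymmetry_of_isDiamComplete hK]
  have hb := hK.1.2.1.isBounded
  rcases (Metric.diam_nonneg (s := K)).eq_or_lt with h0 | hpos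
  · rw [circumradius_eq_zero hb hK.1.1 h0.symm, zero_div]
    positivity
  · have h1 := circumradius_lt_diam hb hK.1.1 hpos
    have h2 := circumradius_le_him hb hK.1.1
    have hk : (0 : ℝ) < (him E : ℝ) + 1 := by positivity
    rw [div_mul_eq_mul_div, le_div_iff₀ hk] at h2
    rw [div_le_iff₀ (by linarith)]
    linarith

lemma isGreatest_asymmetry_completion {x : Fin (him E + 1) → E}
    (hpos : 0 < Metric.diam (Set.range x))
    (hmax : ∀ K : Set E, Bornology.IsBounded K → K.Nonempty →
      circumradius K * Metric.diam (Set.range x) ≤ circumradius (Set.range x) * Metric.diam K)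
    {T : Set E} (hT : IsCompletion (Set.range x) T) :
    IsGreatest (completeAsymmetries E) (asymmetry T) := by
  have hTb := hT.2.1.1.2.1.isBounded
  obtain ⟨c, hc⟩ := exists_isCircumcenter hTb hT.2.1.1.1
  have hmono := circumradius_mono hT.1 hc
  have hTD : 0 < Metric.diam T := hT.2.2 ▸ hpos
  have hTlt := circumradius_lt_diam hTb hT.2.1.1.1 hTD
  refine ⟨⟨T, hT.2.1, rfl⟩, ?_⟩
  rintro _ ⟨K, hK, rfl⟩
  have hKb := hK.1.2.1.isBounded
  rw [asymmetry_of_isDiamComplete hK, asymmetry_of_isDiamComplete hT.2.1]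
  rcases (Metric.diam_nonneg (s := K)).eq_or_lt with h0 | hK0
  · rw [circumradius_eq_zero hKb hK.1.1 h0.symm, zero_div]
    exact div_nonneg (circumradius_nonneg T) (by linarith)
  · refine div_sub_le_div_sub (circumradius_lt_diam hKb hK.1.1 hK0) hTlt ?_
    rw [hT.2.2]
    exact (hmax K hKb hK.1.1).trans (mul_le_mul_of_nonneg_right hmono hK0.le)

variable (E) in
lemma isGreatest_asymmetryConstant :
    IsGreatest (completeAsymmetries E) (asymmetryConstant E) := by
  suffices h : ∃ s, IsGreatest (completeAsymmetries E) s by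
    obtain ⟨s, hs⟩ := h
    rwa [asymmetryConstant, hs.csSup_eq]
  -- The zero space has no tuple of positive diameter.
  rcases subsingleton_or_nontrivial E with hE | hE
  · have h : ∀ K : Set E, IsDiamComplete K → asymmetry K = 0 := by
      intro K hK
      obtain ⟨x, hx⟩ := hK.1.1
      rw [(Set.subsingleton_of_subsingleton (s := K)).eq_singleton_of_mem hx,
        asymmetry_singleton]
    obtain ⟨T, hT⟩ := exists_isCompletion (Bornology.isBounded_singleton (x := (0 : E)))
      (Set.singleton_nonempty _)
    refine ⟨0, ⟨T, hT.2.1, h T hT.2.1⟩, ?_⟩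
    rintro _ ⟨K, hK, rfl⟩
    exact (h K hK).le
  · obtain ⟨x, hpos, hmax⟩ := exists_tuple_max_circumradius E
    obtain ⟨T, hT⟩ := exists_isCompletion (Set.finite_range x).isBounded (Set.range_nonempty x)
    exact ⟨_, isGreatest_asymmetry_completion hpos hmax hT⟩

/-- For simplices of the Helly dimension, equality of the asymmetries means that the circumradius
is extremal for the given diameter. -/
lemma equalAsymmetries_iff {S : Set E} (hS : IsSimplex (him E) S) {c : E}
    (hc : IsCircumcenter S c) :
    EqualAsymmetries S c ↔ circumradius S = (him E : ℝ) / (him E + 1) * Metric.diam S := by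
  have hk := (him_spec E).1
  have hpos := diam_pos_of_isSimplex hk hS
  obtain ⟨hb, hne⟩ := isBounded_of_isSimplex hS
  have hlt := circumradius_lt_diam hb hne hpos
  rw [EqualAsymmetries, asymmetry_of_isSimplex hk hS, asymmetry_pseudoCompletion hc hne hpos,
    ← div_sub_eq_natCast_iff _ hlt]
  refine ⟨fun h => h.1.symm, fun h => ⟨h.symm, fun T hT => ?_⟩⟩
  rw [h]
  -- A completion has the same diameter and no smaller circumradius, so its asymmetry is at least,
  -- hence exactly, `him E`.
  refine le_antisymm ?_ (asymmetry_le_him hT.2.1)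
  have hTb := hT.2.1.1.2.1.isBounded
  obtain ⟨c', hc'⟩ := exists_isCircumcenter hTb hT.2.1.1.1
  rw [asymmetry_of_isDiamComplete hT.2.1, ← h]
  refine div_sub_le_div_sub hlt
    (circumradius_lt_diam hTb hT.2.1.1.1 (by rwa [hT.2.2])) ?_
  rw [hT.2.2]
  exact mul_le_mul_of_nonneg_right (circumradius_mono hT.1 hc') hpos.le

/-- If the asymmetry constant equals the Helly dimension, some simplex of that dimension has
extremal circumradius. -/
lemma exists_isSimplex_of_asymmetryConstant_eq (h : asymmetryConstant E = him E) :
    ∃ S : Set E, IsSimplex (him E) S ∧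
      circumradius S = (him E : ℝ) / (him E + 1) * Metric.diam S := by
  have hk : (0 : ℝ) < him E := by exact_mod_cast (him_spec E).1
  obtain ⟨K, hK, hKs⟩ := (isGreatest_asymmetryConstant E).1
  rw [h, asymmetry_of_isDiamComplete hK] at hKs
  have hKb := hK.1.2.1.isBounded
  have hKpos : 0 < Metric.diam K := by
    refine lt_of_le_of_ne Metric.diam_nonneg fun h0 => ?_
    rw [circumradius_eq_zero hKb hK.1.1 h0.symm, zero_div] at hKs
    exact hk.ne hKs
  rw [div_sub_eq_natCast_iff _ (circumradius_lt_diam hKb hK.1.1 hKpos)] at hKs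
  have : Nontrivial E := by
    by_contra hE
    rw [not_nontrivial_iff_subsingleton] at hE
    exact hKpos.ne' (Metric.diam_subsingleton Set.subsingleton_of_subsingleton)
  obtain ⟨x, hpos, hmax⟩ := exists_tuple_max_circumradius E
  have hx : circumradius (Set.range x) =
      (him E : ℝ) / (him E + 1) * Metric.diam (Set.range x) := by
    refine le_antisymm
      (circumradius_le_him (Set.finite_range x).isBounded (Set.range_nonempty x)) ?_
    have := hmax K hKb hK.1.1
    rw [hKs, mul_right_comm] at this
    exact le_of_mul_le_mul_right this hKpos
  refine ⟨convexHull ℝ (Set.range x), ⟨x, affineIndependent_of_facet_functional hpos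
    (exists_facet_functional_of_circumradius_eq hpos hx), rfl⟩, ?_⟩
  rwa [circumradius_convexHull, convexHull_diam]

lemma asymmetryConstant_eq_of_equalAsymmetries {S : Set E} (hS : IsSimplex (him E) S) {c : E}
    (h : EqualAsymmetries S c) : asymmetryConstant E = him E := by
  obtain ⟨hb, hne⟩ := isBounded_of_isSimplex hS
  -- Without an existing completion the second equality would be vacuous.
  obtain ⟨T, hT⟩ := exists_isCompletion hb hne
  have hs := h.1.trans (h.2 T hT)
  rw [asymmetry_of_isSimplex (him_spec E).1 hS] at hs
  obtain ⟨K, hK, hKs⟩ := (isGreatest_asymmetryConstant E).1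
  refine le_antisymm (hKs ▸ asymmetry_le_him hK) ?_
  exact (isGreatest_asymmetryConstant E).2 ⟨T, hT.2.1, hs.symm⟩

lemma eq_pseudoCompletion_inter_affineSpan {S : Set E} (hS : IsSimplex (him E) S)
    (h : circumradius S = (him E : ℝ) / (him E + 1) * Metric.diam S) {c : E}
    (hc : IsCircumcenter S c) :
    S = pseudoCompletion S c ∩ (affineSpan ℝ S : Set E) := by
  have hpos := diam_pos_of_isSimplex (him_spec E).1 hS
  obtain ⟨x, -, rfl⟩ := hS
  refine Set.Subset.antisymm
    (Set.subset_inter (subset_pseudoCompletion _ c) (subset_affineSpan ℝ _)) ?_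
  refine pseudoCompletion_inter_affineSpan_subset hpos (fun i => ?_) hc
  rw [circumradius_convexHull, convexHull_diam] at h
  rw [convexHull_diam] at hpos ⊢
  exact exists_facet_functional_of_circumradius_eq hpos h i

end

end MinkowskiSpace

theorem mainTheorem3 {E : Type*} [NormedAddCommGroup E] [NormedSpace ℝ E]
    [FiniteDimensional ℝ E] :
    IsGreatest (MinkowskiSpace.completeAsymmetries E) (MinkowskiSpace.asymmetryConstant E) ∧
    ⌈MinkowskiSpace.asymmetryConstant E⌉ ≤ (MinkowskiSpace.him E : ℤ) ∧
    (MinkowskiSpace.asymmetryConstant E = (MinkowskiSpace.him E : ℝ) ↔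
      ∃ S : Set E, MinkowskiSpace.IsSimplex (MinkowskiSpace.him E) S ∧
        ∃ c : E, MinkowskiSpace.IsCircumcenter S c ∧ MinkowskiSpace.EqualAsymmetries S c) ∧
    (MinkowskiSpace.asymmetryConstant E = (MinkowskiSpace.him E : ℝ) ↔
      ∃ S : Set E, MinkowskiSpace.IsSimplex (MinkowskiSpace.him E) S ∧
        ∀ c : E, MinkowskiSpace.IsCircumcenter S c → MinkowskiSpace.EqualAsymmetries S c) ∧
    (∀ S : Set E, MinkowskiSpace.IsSimplex (MinkowskiSpace.him E) S →
      (∃ c : E, MinkowskiSpace.IsCircumcenter S c ∧ MinkowskiSpace.EqualAsymmetries S c) →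
      ∀ c : E, MinkowskiSpace.IsCircumcenter S c →
        S = MinkowskiSpace.pseudoCompletion S c ∩ (affineSpan ℝ S : Set E)) := by
  have hgreat := MinkowskiSpace.isGreatest_asymmetryConstant E
  have hforall : MinkowskiSpace.asymmetryConstant E = (MinkowskiSpace.him E : ℝ) →
      ∃ S : Set E, MinkowskiSpace.IsSimplex (MinkowskiSpace.him E) S ∧
        ∀ c : E, MinkowskiSpace.IsCircumcenter S c → MinkowskiSpace.EqualAsymmetries S c := by
    intro h
    obtain ⟨S, hS, hSR⟩ := MinkowskiSpace.exists_isSimplex_of_asymmetryConstant_eq h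
    exact ⟨S, hS, fun c hc => (MinkowskiSpace.equalAsymmetries_iff hS hc).2 hSR⟩
  -- Keeps the version quantified over every circumcenter from being vacuous.
  have hcenter : ∀ S : Set E, MinkowskiSpace.IsSimplex (MinkowskiSpace.him E) S → ∃ c, MinkowskiSpace.IsCircumcenter S c :=
    fun S hS => MinkowskiSpace.exists_isCircumcenter (MinkowskiSpace.isBounded_of_isSimplex hS).1 (MinkowskiSpace.isBounded_of_isSimplex hS).2
  refine ⟨hgreat, ?_, ⟨fun h => ?_, ?_⟩, ⟨hforall, ?_⟩, ?_⟩
  · obtain ⟨K, hK, hKs⟩ := hgreat.1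
    rw [Int.ceil_le, ← hKs]
    exact_mod_cast MinkowskiSpace.asymmetry_le_him hK
  · obtain ⟨S, hS, hall⟩ := hforall h
    obtain ⟨c, hc⟩ := hcenter S hS
    exact ⟨S, hS, c, hc, hall c hc⟩
  · rintro ⟨S, hS, c, -, h⟩
    exact MinkowskiSpace.asymmetryConstant_eq_of_equalAsymmetries hS h
  · rintro ⟨S, hS, hall⟩
    obtain ⟨c, hc⟩ := hcenter S hS
    exact MinkowskiSpace.asymmetryConstant_eq_of_equalAsymmetries hS (hall c hc)
  · rintro S hS ⟨c', hc', h⟩ c hc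
    exact MinkowskiSpace.eq_pseudoCompletion_inter_affineSpan hS ((MinkowskiSpace.equalAsymmetries_iff hS hc').1 h) hc
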